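/- **Theorem 3.1.** Let $d\ge 1$, $0<\alpha<d$ and $1\le s_1<s_2\le d/\alpha$. Write $|f|_p$ for the norm of $L_p(\mathbb R^d)$ and $$R_\alpha[f](x)=\int_{\mathbb R^d}\frac{f(y)\,dy}{|x-y|^{d-\alpha}}$$ for the Riesz potential of a real function $f$ on $\mathbb R^d$. For $1<p<d/\alpha$ define $q=q(p)$ by $1/q=1/p-\alpha/d$, let $p=p(q)$ be the inverse relation, and put $$K_{R,\alpha}(p)=\sup_{0\ne f\in L_p(\mathbb R^d)}\frac{|R_\alpha[f]|_{q(p)}}{|f|_p}.$$ For $1\le a<b\le\infty$ and a function $\psi$ on $(a,b)$ with values in $(0,\infty)$, the Grand Lebesgue space $G\psi=G\psi(a,b)$ consists of the measurable $f:\mathbb R^d\to\mathbb R$ with $$\|f\|_{G\psi}=\sup_{a<r<b}\frac{|f|_r}{\psi(r)}<\infty .$$ Let $G\Psi(s_1,s_2)$ be the set of all continuous functions $\psi$ on $(s_1,s_2)$ that are bounded from below by a positive constant. For $\psi\in G\Psi(s_1,s_2)$ define $$\psi_K(q)=K_{R,\alpha}(p(q))\,\psi(p(q)),\qquad q(s_1)<q<q(s_2),$$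 where $q(s_1)$ and $q(s_2)$ are given by the same relation, with $q(d/\alpha)=\infty$. Then $0<K_{R,\alpha}(p)<\infty$ for all $p\in(s_1,s_2)$. For every $\psi\in G\Psi(s_1,s_2)$ and every $f\in G\psi$, the integral $R_\alpha[f](x)$ converges absolutely for almost every $x$, $R_\alpha[f]\in G\psi_K$, and $$\|R_\alpha[f]\|_{G\psi_K}\le\|f\|_{G\psi}.$$ The constant $1$ is best possible: if $C\in[0,\infty]$ is such that $\|R_\alpha[f]\|_{G\psi_K}\le C\,\|f\|_{G\psi}$ for all $\psi\in G\Psi(s_1,s_2)$ and all $f\in G\psi$, then $C\ge 1$. -/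

import Mathlib

open MeasureTheory Set
open scoped ENNReal

noncomputable section

/-- The `Ψ`-functions on the open interval `(s₁, s₂)`: continuous, finite, and bounded from below
by a positive constant there. Exponents live in `[0, ∞]`, so that `s₂ = ∞` is allowed; all `q` with
`s₁ < q < s₂` are finite. Values outside the interval are irrelevant. -/
structure IsPsiFunction (ψ : ℝ≥0∞ → ℝ≥0∞) (s₁ s₂ : ℝ≥0∞) : Prop where
  continuousOn : ContinuousOn ψ (Ioo s₁ s₂)
  ne_top : ∀ q ∈ Ioo s₁ s₂, ψ q ≠ ∞
  bddBelow : ∃ c : ℝ≥0∞, 0 < c ∧ ∀ q ∈ Ioo s₁ s₂, c ≤ ψ q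

/-- The Grand Lebesgue norm `sup_{s₁ < q < s₂} |f|_q / ψ(q)` over `ℝᵈ` with Lebesgue measure. -/
def grandLebesgueNorm {d : ℕ} (ψ : ℝ≥0∞ → ℝ≥0∞) (s₁ s₂ : ℝ≥0∞)
    (f : EuclideanSpace ℝ (Fin d) → ℝ) : ℝ≥0∞ :=
  ⨆ q ∈ Ioo s₁ s₂, eLpNorm f q volume / ψ q

/-- Membership in the Grand Lebesgue space `Gψ(s₁, s₂)` over `ℝᵈ`. -/
structure MemGrandLebesgue {d : ℕ} (ψ : ℝ≥0∞ → ℝ≥0∞) (s₁ s₂ : ℝ≥0∞)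
    (f : EuclideanSpace ℝ (Fin d) → ℝ) : Prop where
  aestronglyMeasurable : AEStronglyMeasurable f volume
  norm_lt_top : grandLebesgueNorm ψ s₁ s₂ f < ∞

/-- The integrand `y ↦ f(y) / |x - y|^(d - α)` of the Riesz potential at `x`. -/
def rieszIntegrand {d : ℕ} (α : ℝ) (f : EuclideanSpace ℝ (Fin d) → ℝ)
    (x y : EuclideanSpace ℝ (Fin d)) : ℝ :=
  f y / ‖x - y‖ ^ ((d : ℝ) - α)

/-- The Riesz potential `R_α[f](x) = ∫ f(y) / |x - y|^(d - α) dy`. -/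
def rieszPotential {d : ℕ} (α : ℝ) (f : EuclideanSpace ℝ (Fin d) → ℝ)
    (x : EuclideanSpace ℝ (Fin d)) : ℝ :=
  ∫ y, rieszIntegrand α f x y

/-- The exponent `q = q(p)` given by `1/q = 1/p - α/d`; in particular `q(d/α) = ∞`. -/
def exponentQ (d : ℕ) (α : ℝ) (p : ℝ≥0∞) : ℝ≥0∞ :=
  (p⁻¹ - ENNReal.ofReal (α / d))⁻¹

/-- The inverse relation `p = p(q)`, given by `1/p = 1/q + α/d`. -/
def exponentP (d : ℕ) (α : ℝ) (q : ℝ≥0∞) : ℝ≥0∞ :=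
  (q⁻¹ + ENNReal.ofReal (α / d))⁻¹

/-- `K_{R,α}(p)`, the supremum over `0 ≠ f ∈ L_p(ℝᵈ)` of `|R_α[f]|_q / |f|_p`, with
`q = q(p)`. -/
def rieszConstant (d : ℕ) (α : ℝ) (p : ℝ≥0∞) : ℝ≥0∞ :=
  ⨆ (f : EuclideanSpace ℝ (Fin d) → ℝ) (_ : MemLp f p volume) (_ : eLpNorm f p volume ≠ 0),
    eLpNorm (rieszPotential α f) (exponentQ d α p) volume / eLpNorm f p volume

/-- `ψ_K(q) = K_{R,α}(p(q)) ψ(p(q))`. -/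
def psiK (d : ℕ) (α : ℝ) (ψ : ℝ≥0∞ → ℝ≥0∞) (q : ℝ≥0∞) : ℝ≥0∞ :=
  rieszConstant d α (exponentP d α q) * ψ (exponentP d α q)

end

/-! ### Power integrals -/

/-! The upper bound is the inequality |R_α f|_q ≤ K(p)|f|_p read at every exponent: with p = p(q)
the factor K(p) in ψ_K cancels and |f|_p/ψ(p) remains (`grandLebesgueNorm_rieszPotential_le`). The
cancellation needs 0 < K(p) < ∞.

Finiteness is the Hardy–Littlewood–Sobolev inequality, obtained by Hedberg's method. The potential
is an integral over r of the mass of f in B(x, r); small radii are controlled by the maximal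
function M, large ones by Hölder. The radius that balances the two gives R_α|f| ≤ C |f|_p^θ
(Mf)^(1-θ) with (1-θ)q = p, and the L_p bound for M (Vitali covering plus layer cake) concludes.
Bounding the potential of |f| also gives absolute convergence almost everywhere. Positivity of K(p)
is tested on the indicator of a ball.

For sharpness, fix a single p and take g nearly extremal for K(p), bounded and of bounded support
(`exists_bounded_lt_eLpNorm_rieszPotential`). Then ψ(r) = |g|_r is an admissible weight with ‖g‖ ≤ 1
in Gψ, while the one term q = q(p) of the norm of R_α g is already close to 1. Neither an extremal
function nor the value of K(p) is needed. -/

theorem lintegral_Ioo_zero_rpow {s b : ℝ} (hs : 0 < s) (hb : 0 ≤ b) :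
    ∫⁻ t in Ioo 0 b, ENNReal.ofReal (t ^ (s - 1)) = ENNReal.ofReal (b ^ s / s) := by
  have hint : IntervalIntegrable (fun t : ℝ => t ^ (s - 1)) volume 0 b :=
    intervalIntegral.intervalIntegrable_rpow' (by linarith)
  rw [restrict_Ioo_eq_restrict_Ioc, ← ofReal_integral_eq_lintegral_ofReal,
    ← intervalIntegral.integral_of_le hb, integral_rpow (Or.inl (by linarith))]
  · simp [Real.zero_rpow hs.ne']
  · exact (intervalIntegrable_iff_integrableOn_Ioc_of_le hb).1 hint
  · filter_upwards [ae_restrict_mem measurableSet_Ioc] with t ht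
    exact Real.rpow_nonneg ht.1.le _

theorem lintegral_Ioi_rpow {s b : ℝ} (hs : 0 < s) (hb : 0 < b) :
    ∫⁻ t in Ioi b, ENNReal.ofReal (t ^ (-s - 1)) = ENNReal.ofReal (b ^ (-s) / s) := by
  rw [← ofReal_integral_eq_lintegral_ofReal, integral_Ioi_rpow_of_lt (by linarith) hb]
  · congr 1
    rw [sub_add_cancel, neg_div_neg_eq]
  · exact integrableOn_Ioi_rpow_of_lt (by linarith) hb
  · filter_upwards [ae_restrict_mem measurableSet_Ioi] with t ht
    exact Real.rpow_nonneg (hb.trans ht).le _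

/-- Layer-cake formula for a power of an extended nonnegative number. -/
theorem lintegral_indicator_ofReal_lt_rpow {s : ℝ} (hs : 0 < s) (g : ℝ≥0∞) :
    ∫⁻ t in Ioi (0 : ℝ),
      {t : ℝ | ENNReal.ofReal t < g}.indicator (fun t => ENNReal.ofReal (t ^ (s - 1))) t
      = g ^ s / ENNReal.ofReal s := by
  have hm (g : ℝ≥0∞) : MeasurableSet {t : ℝ | ENNReal.ofReal t < g} :=
    measurableSet_lt ENNReal.measurable_ofReal measurable_const
  have hfin {b : ℝ} (hb : 0 ≤ b) : ∫⁻ t in Ioi (0 : ℝ),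
      {t : ℝ | ENNReal.ofReal t < ENNReal.ofReal b}.indicator
        (fun t => ENNReal.ofReal (t ^ (s - 1))) t = ENNReal.ofReal (b ^ s / s) := by
    rw [lintegral_indicator (hm _), Measure.restrict_restrict (hm _), ← lintegral_Ioo_zero_rpow hs hb]
    congr 2
    ext t
    simp only [mem_inter_iff, mem_ofPred_eq, mem_Ioi, mem_Ioo]
    constructor
    · rintro ⟨h, h0⟩
      exact ⟨h0, (ENNReal.ofReal_lt_ofReal_iff_of_nonneg h0.le).1 h⟩
    · rintro ⟨h0, h⟩
      exact ⟨(ENNReal.ofReal_lt_ofReal_iff_of_nonneg h0.le).2 h, h0⟩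
  rcases eq_or_ne g ∞ with rfl | hg
  · rw [ENNReal.top_rpow_of_pos hs, ENNReal.top_div_of_ne_top ENNReal.ofReal_ne_top]
    refine ENNReal.eq_top_of_forall_nnreal_le fun r => ?_
    -- This height makes the finite case evaluate to exactly `r`, so the integral for g = ∞ exceeds
    -- every finite bound.
    have hb : 0 ≤ (s * r : ℝ) ^ s⁻¹ := by positivity
    have h := hfin hb
    rw [Real.rpow_inv_rpow (by positivity) hs.ne', mul_div_cancel_left₀ _ hs.ne',
      ENNReal.ofReal_coe_nnreal] at h
    rw [← h]
    refine lintegral_mono fun t => ?_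
    exact indicator_le_indicator_of_subset (fun t _ => ENNReal.ofReal_lt_top) (fun _ => zero_le) t
  · have h := hfin (ENNReal.toReal_nonneg (a := g))
    rw [ENNReal.ofReal_toReal hg] at h
    rw [h, ENNReal.ofReal_div_of_pos hs, ← ENNReal.ofReal_rpow_of_nonneg ENNReal.toReal_nonneg hs.le,
      ENNReal.ofReal_toReal hg]

/-! ### The Hardy–Littlewood maximal function -/

section Maximal

open Metric Module

variable {E : Type*} [NormedAddCommGroup E] [MeasurableSpace E]

/-- The uncentred Hardy–Littlewood maximal function over open balls. -/
noncomputable def ballMaximal (μ : Measure E) (f : E → ℝ≥0∞) (x : E) : ℝ≥0∞ :=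
  ⨆ (c : E) (r : ℝ), (ball c r).indicator (fun _ => (∫⁻ y in ball c r, f y ∂μ) / μ (ball c r)) x

variable {μ : Measure E}

/-- Open uncentred balls make every superlevel set open, so the maximal function is measurable even
when `f` is not. -/
theorem lowerSemicontinuous_ballMaximal (f : E → ℝ≥0∞) :
    LowerSemicontinuous (ballMaximal μ f) :=
  lowerSemicontinuous_iSup fun _ => lowerSemicontinuous_iSup fun _ =>
    isOpen_ball.lowerSemicontinuous_indicator zero_le

theorem lt_ballMaximal_iff {f : E → ℝ≥0∞} {t : ℝ≥0∞} {x : E} :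
    t < ballMaximal μ f x ↔
      ∃ c r, x ∈ ball c r ∧ t < (∫⁻ y in ball c r, f y ∂μ) / μ (ball c r) := by
  simp only [ballMaximal, lt_iSup_iff]
  refine exists₂_congr fun c r => ?_
  by_cases hx : x ∈ ball c r <;> simp [hx]

theorem setLIntegral_div_le_ballMaximal (f : E → ℝ≥0∞) {x c : E} {r : ℝ} (hx : x ∈ ball c r) :
    (∫⁻ y in ball c r, f y ∂μ) / μ (ball c r) ≤ ballMaximal μ f x := by
  refine le_trans ?_ (le_iSup₂ (f := fun (c : E) (r : ℝ) => (ball c r).indicator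
    (fun _ => (∫⁻ y in ball c r, f y ∂μ) / μ (ball c r)) x) c r)
  simp [hx]

theorem measurable_ballMaximal [BorelSpace E] (f : E → ℝ≥0∞) : Measurable (ballMaximal μ f) :=
  (lowerSemicontinuous_ballMaximal f).measurable

variable [NormedSpace ℝ E] [FiniteDimensional ℝ E] [μ.IsAddHaarMeasure]

theorem setLIntegral_ball_le_ballMaximal_mul (f : E → ℝ≥0∞) (x : E) {r : ℝ} (hr : 0 < r) :
    ∫⁻ y in ball x r, f y ∂μ ≤ ballMaximal μ f x * μ (ball x r) :=
  (ENNReal.div_le_iff (measure_ball_pos μ x hr).ne' measure_ball_lt_top.ne).1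
    (setLIntegral_div_le_ballMaximal f (mem_ball_self hr))

/-- The part of `f` that is at most t/2 contributes at most t/2 to any ball average. -/
theorem ballMaximal_le_add (f : E → ℝ≥0∞) (t : ℝ≥0∞) (x : E) :
    ballMaximal μ f x ≤ ballMaximal μ ({y | t < 2 * f y}.indicator f) x + t / 2 := by
  refine iSup₂_le fun c r => ?_
  by_cases hx : x ∈ ball c r
  · have hr : 0 < r := pos_of_mem_ball hx
    have h0 := (measure_ball_pos μ c hr).ne'
    have ht := (measure_ball_lt_top (μ := μ) (x := c) (r := r)).ne
    rw [indicator_of_mem hx]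
    refine le_trans ?_ (add_le_add_left (setLIntegral_div_le_ballMaximal _ hx) _)
    rw [ENNReal.div_le_iff h0 ht, add_mul, ENNReal.div_mul_cancel h0 ht]
    calc ∫⁻ y in ball c r, f y ∂μ
        ≤ ∫⁻ y in ball c r, ({y | t < 2 * f y}.indicator f y + t / 2) ∂μ := by
          refine lintegral_mono fun y => ?_
          by_cases hy : t < 2 * f y
          · rw [indicator_of_mem (by exact hy)]
            exact le_self_add
          · rw [indicator_of_notMem (by exact hy), zero_add,
              ENNReal.le_div_iff_mul_le (by simp) (by simp), mul_comm]
            exact not_lt.1 hy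
      _ = _ := by
          rw [lintegral_add_right _ measurable_const]
          simp
  · simp [hx]

variable [BorelSpace E]

/-- The weak type `(1, 1)` inequality for the maximal function. -/
theorem mul_measure_lt_ballMaximal_le [Nontrivial E] (f : E → ℝ≥0∞) {t : ℝ≥0∞} :
    t * μ {x | t < ballMaximal μ f x} ≤ 5 ^ finrank ℝ E * ∫⁻ y, f y ∂μ := by
  rcases eq_or_ne t 0 with rfl | ht
  · simp
  rcases eq_or_ne t ∞ with rfl | ht'
  · simp
  rcases eq_or_ne (∫⁻ y, f y ∂μ) ∞ with hf | hf
  · simp [hf, ENNReal.mul_top]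
  set n := finrank ℝ E with hn
  have hn0 : n ≠ 0 := (finrank_pos (R := ℝ) (M := E)).ne'
  set v := μ (ball (0 : E) 1) with hv
  have hv0 : v ≠ 0 := (measure_ball_pos μ _ one_pos).ne'
  have hvt : v ≠ ∞ := measure_ball_lt_top.ne
  -- The balls with average above `t`; they cover the superlevel set.
  let T : Set (E × ℝ) := {a | 0 < a.2 ∧ t * μ (ball a.1 a.2) < ∫⁻ y in ball a.1 a.2, f y ∂μ}
  -- Vitali's lemma needs bounded radii. A ball in `T` satisfies r^n ≤ ∫f/(tv), and r ≤ r^n once r >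
  -- 1, which explains the maximum with 1.
  have hR : ∀ a ∈ T, a.2 ≤ max 1 ((∫⁻ y, f y ∂μ) / (t * v)).toReal := by
    rintro ⟨c, r⟩ ⟨hr, h⟩
    dsimp only at hr h ⊢
    by_contra! hlt
    obtain ⟨h1, h2⟩ := max_lt_iff.1 hlt
    have h3 : ENNReal.ofReal (r ^ n) ≤ (∫⁻ y, f y ∂μ) / (t * v) := by
      rw [ENNReal.le_div_iff_mul_le (Or.inl (mul_ne_zero ht hv0))
        (Or.inl (ENNReal.mul_ne_top ht' hvt))]
      rw [Measure.addHaar_ball μ c hr.le] at h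
      calc ENNReal.ofReal (r ^ n) * (t * v) = t * (ENNReal.ofReal (r ^ n) * v) := by ring
        _ ≤ ∫⁻ y in ball c r, f y ∂μ := h.le
        _ ≤ _ := setLIntegral_le_lintegral _ _
    have h4 : r ^ n ≤ ((∫⁻ y, f y ∂μ) / (t * v)).toReal :=
      (ENNReal.ofReal_le_iff_le_toReal
        (ENNReal.div_ne_top hf (mul_ne_zero ht hv0))).1 h3
    exact absurd (le_self_pow₀ h1.le hn0) (not_le.2 (h4.trans_lt h2))
  obtain ⟨u, huT, hdisj, hcov⟩ := Vitali.exists_disjoint_subfamily_covering_enlargement_closedBall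
    T (fun a => a.1) (fun a => a.2) _ hR 5 (by norm_num)
  have hdisj' : u.PairwiseDisjoint fun a : E × ℝ => ball a.1 a.2 :=
    hdisj.mono fun a => ball_subset_closedBall
  have huc : u.Countable := hdisj'.countable_of_isOpen (fun _ _ => isOpen_ball)
    fun a ha => nonempty_ball.2 (huT ha).1
  have hsub : {x | t < ballMaximal μ f x} ⊆ ⋃ a ∈ u, closedBall a.1 (5 * a.2) := by
    intro x hx
    obtain ⟨c, r, hxr, hlt⟩ := lt_ballMaximal_iff.1 hx
    have hr : 0 < r := pos_of_mem_ball hxr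
    have hcr : (c, r) ∈ T := ⟨hr, (ENNReal.lt_div_iff_mul_lt
      (Or.inl (measure_ball_pos μ c hr).ne') (Or.inl measure_ball_lt_top.ne)).1 hlt⟩
    obtain ⟨b, hb, hbsub⟩ := hcov _ hcr
    exact mem_biUnion hb (hbsub (ball_subset_closedBall hxr))
  have hball : ∀ a ∈ u, t * μ (closedBall a.1 (5 * a.2)) ≤
      5 ^ n * ∫⁻ y in ball a.1 a.2, f y ∂μ := by
    intro a ha
    obtain ⟨hr, h⟩ := huT ha
    rw [Measure.addHaar_ball μ _ hr.le] at h
    rw [Measure.addHaar_closedBall μ _ (by positivity), mul_pow,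
      ENNReal.ofReal_mul (by positivity), ENNReal.ofReal_pow (by norm_num)]
    calc t * (ENNReal.ofReal 5 ^ n * ENNReal.ofReal (a.2 ^ n) * v)
        = 5 ^ n * (t * (ENNReal.ofReal (a.2 ^ n) * v)) := by
          rw [ENNReal.ofReal_ofNat]; ring
      _ ≤ _ := by gcongr
  have := huc.to_subtype
  calc t * μ {x | t < ballMaximal μ f x}
      ≤ t * ∑' a : u, μ (closedBall a.1.1 (5 * a.1.2)) := by
        gcongr
        exact (measure_mono hsub).trans (measure_biUnion_le _ huc _)
    _ = ∑' a : u, t * μ (closedBall a.1.1 (5 * a.1.2)) := ENNReal.tsum_mul_left.symm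
    _ ≤ ∑' a : u, 5 ^ n * ∫⁻ y in ball a.1.1 a.1.2, f y ∂μ :=
        ENNReal.tsum_le_tsum fun a => hball a a.2
    _ = 5 ^ n * ∫⁻ y in ⋃ a ∈ u, ball a.1 a.2, f y ∂μ := by
        rw [ENNReal.tsum_mul_left,
          lintegral_biUnion huc (fun _ _ => measurableSet_ball) hdisj']
    _ ≤ 5 ^ n * ∫⁻ y, f y ∂μ := by gcongr; exact Measure.restrict_le_self

/-- Where Mf exceeds t, the maximal function of the part of f above t/2 exceeds t/2. Keeping only
that part on the right is what makes the integral over t converge in the strong type bound. -/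
theorem measure_lt_ballMaximal_le [Nontrivial E] {f : E → ℝ≥0∞} {t : ℝ≥0∞}
    (ht : t ≠ 0) (ht' : t ≠ ∞) :
    μ {x | t < ballMaximal μ f x} ≤
      2 * 5 ^ finrank ℝ E * (t⁻¹ * ∫⁻ y, {y | t < 2 * f y}.indicator f y ∂μ) := by
  have hsub : {x | t < ballMaximal μ f x} ⊆
      {x | t / 2 < ballMaximal μ ({y | t < 2 * f y}.indicator f) x} := by
    intro x hx
    by_contra! h
    refine absurd (hx.trans_le (ballMaximal_le_add f t x)) (not_lt.2 ?_)
    calc _ ≤ t / 2 + t / 2 := by gcongr; exact not_lt.1 h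
      _ = t := ENNReal.add_halves t
  have h := mul_measure_lt_ballMaximal_le (μ := μ) ({y | t < 2 * f y}.indicator f) (t := t / 2)
  refine (measure_mono hsub).trans ?_
  have h0 : t / 2 ≠ 0 := by simp [ht]
  have h1 : t / 2 ≠ ∞ := ENNReal.div_ne_top ht' (by simp)
  rw [mul_comm, ← ENNReal.le_div_iff_mul_le (Or.inl h0) (Or.inl h1)] at h
  refine h.trans_eq ?_
  rw [div_eq_mul_inv, ENNReal.inv_div (by simp) (by simp), div_eq_mul_inv]
  ring

/-- The strong type `(p, p)` inequality for the maximal function. -/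
theorem exists_lintegral_ballMaximal_rpow_le [Nontrivial E] (μ : Measure E) [μ.IsAddHaarMeasure]
    {p : ℝ} (hp : 1 < p) :
    ∃ C : ℝ≥0∞, C ≠ ∞ ∧ ∀ f : E → ℝ≥0∞, Measurable f →
      ∫⁻ x, ballMaximal μ f x ^ p ∂μ ≤ C * ∫⁻ x, f x ^ p ∂μ := by
  have hp0 : 0 < p := one_pos.trans hp
  have hp1 : 0 < p - 1 := sub_pos.2 hp
  set K : ℝ≥0∞ := 2 * 5 ^ finrank ℝ E with hK
  have hKt : K ≠ ∞ := by rw [hK]; finiteness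
  refine ⟨ENNReal.ofReal p * (K * (2 ^ (p - 1) / ENNReal.ofReal (p - 1))), ?_, fun f hf => ?_⟩
  · have : ENNReal.ofReal (p - 1) ≠ 0 := by simpa using hp
    have h2 : (2 : ℝ≥0∞) ^ (p - 1) ≠ ∞ := ENNReal.rpow_ne_top_of_nonneg hp1.le (by simp)
    exact ENNReal.mul_ne_top (by simp) (ENNReal.mul_ne_top hKt (ENNReal.div_ne_top h2 this))
  have hpow (s : ℝ) : Measurable fun t : ℝ => ENNReal.ofReal (t ^ s) := by fun_prop
  have hlayer {g : E → ℝ≥0∞} (hg : Measurable g) (s : ℝ) :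
      Measurable (Function.uncurry fun (x : E) (t : ℝ) =>
        {t : ℝ | ENNReal.ofReal t < g x}.indicator (fun t => ENNReal.ofReal (t ^ (s - 1))) t) := by
    have hset : MeasurableSet {z : E × ℝ | ENNReal.ofReal z.2 < g z.1} :=
      measurableSet_lt (by fun_prop) (by fun_prop)
    exact ((hpow (s - 1)).comp measurable_snd).indicator hset
  -- The weak bound turns t^(p-1) into t^(p-2). Integrated over 0 < t < 2f(x), this is finite
  -- because p > 1 and yields (2f)^(p-1)/(p-1).
  have hstep (t : ℝ) (ht : t ∈ Ioi (0 : ℝ)) :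
      ∫⁻ x, {t : ℝ | ENNReal.ofReal t < ballMaximal μ f x}.indicator
        (fun t => ENNReal.ofReal (t ^ (p - 1))) t ∂μ ≤
      K * ∫⁻ x, f x * {t : ℝ | ENNReal.ofReal t < 2 * f x}.indicator
        (fun t => ENNReal.ofReal (t ^ (p - 1 - 1))) t ∂μ := by
    have ht0 : (0 : ℝ) < t := ht
    have hL : (fun x => {t : ℝ | ENNReal.ofReal t < ballMaximal μ f x}.indicator
        (fun t => ENNReal.ofReal (t ^ (p - 1))) t) =
        {x | ENNReal.ofReal t < ballMaximal μ f x}.indicator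
          fun _ => ENNReal.ofReal (t ^ (p - 1)) := by
      ext x
      simp only [indicator, mem_ofPred_eq]
    have hRt : (fun x => f x * {t : ℝ | ENNReal.ofReal t < 2 * f x}.indicator
        (fun t => ENNReal.ofReal (t ^ (p - 1 - 1))) t) =
        fun x => {y | ENNReal.ofReal t < 2 * f y}.indicator f x *
          ENNReal.ofReal (t ^ (p - 1 - 1)) := by
      ext x
      by_cases h : ENNReal.ofReal t < 2 * f x <;> simp [h]
    have hms : MeasurableSet {y | ENNReal.ofReal t < 2 * f y} :=
      measurableSet_lt measurable_const (by fun_prop)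
    rw [hL, hRt, lintegral_indicator_const
      (measurableSet_lt measurable_const (measurable_ballMaximal f)),
      lintegral_mul_const _ (hf.indicator hms)]
    have hw := measure_lt_ballMaximal_le (μ := μ) (f := f) (t := ENNReal.ofReal t) (by simpa using ht0)
      ENNReal.ofReal_ne_top
    calc _ ≤ ENNReal.ofReal (t ^ (p - 1)) * (K * ((ENNReal.ofReal t)⁻¹ *
          ∫⁻ y, {y | ENNReal.ofReal t < 2 * f y}.indicator f y ∂μ)) := by gcongr
      _ = K * ((∫⁻ y, {y | ENNReal.ofReal t < 2 * f y}.indicator f y ∂μ) *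
          (ENNReal.ofReal (t ^ (p - 1)) * (ENNReal.ofReal t)⁻¹)) := by ring
      _ = _ := by
        rw [← ENNReal.ofReal_inv_of_pos ht0, ← ENNReal.ofReal_mul (by positivity),
          Real.rpow_sub_one ht0.ne' (p - 1), div_eq_mul_inv]
  calc ∫⁻ x, ballMaximal μ f x ^ p ∂μ
      = ENNReal.ofReal p * ∫⁻ x, (∫⁻ t in Ioi (0 : ℝ),
        {t : ℝ | ENNReal.ofReal t < ballMaximal μ f x}.indicator
          (fun t => ENNReal.ofReal (t ^ (p - 1))) t) ∂μ := by
        rw [← lintegral_const_mul']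
        · refine lintegral_congr fun x => ?_
          rw [lintegral_indicator_ofReal_lt_rpow hp0, ENNReal.mul_div_cancel (by simpa using hp0)
            (by simp)]
        · simp
    _ = ENNReal.ofReal p * ∫⁻ t in Ioi (0 : ℝ), ∫⁻ x,
        {t : ℝ | ENNReal.ofReal t < ballMaximal μ f x}.indicator
          (fun t => ENNReal.ofReal (t ^ (p - 1))) t ∂μ := by
        rw [lintegral_lintegral_swap (hlayer (measurable_ballMaximal f) p).aemeasurable]
    _ ≤ ENNReal.ofReal p * ∫⁻ t in Ioi (0 : ℝ), K * ∫⁻ x, f x *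
        {t : ℝ | ENNReal.ofReal t < 2 * f x}.indicator
          (fun t => ENNReal.ofReal (t ^ (p - 1 - 1))) t ∂μ := by
        gcongr ENNReal.ofReal p * ?_
        exact setLIntegral_mono' measurableSet_Ioi hstep
    _ = ENNReal.ofReal p * (K * ∫⁻ x, (∫⁻ t in Ioi (0 : ℝ), f x *
        {t : ℝ | ENNReal.ofReal t < 2 * f x}.indicator
          (fun t => ENNReal.ofReal (t ^ (p - 1 - 1))) t) ∂μ) := by
        rw [lintegral_const_mul' _ _ hKt, lintegral_lintegral_swap]
        exact (((hf.comp measurable_fst).mul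
          (hlayer (hf.const_mul 2) (p - 1))).comp measurable_swap).aemeasurable
    _ = ENNReal.ofReal p * (K * ∫⁻ x, 2 ^ (p - 1) / ENNReal.ofReal (p - 1) * f x ^ p ∂μ) := by
        congr 3
        ext x
        rw [lintegral_const_mul, lintegral_indicator_ofReal_lt_rpow hp1,
          ENNReal.mul_rpow_of_nonneg _ _ hp1.le]
        · have : f x ^ p = f x * f x ^ (p - 1) := by
            conv_lhs => rw [show p = 1 + (p - 1) by ring,
              ENNReal.rpow_add_of_nonneg _ _ zero_le_one hp1.le, ENNReal.rpow_one]
          rw [this, div_eq_mul_inv, div_eq_mul_inv]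
          ring
        · exact (hpow _).indicator (measurableSet_lt ENNReal.measurable_ofReal measurable_const)
    _ = _ := by
        rw [lintegral_const_mul _ (hf.pow_const p)]
        ring

end Maximal

/-! ### The Hardy–Littlewood–Sobolev inequality -/

theorem setLIntegral_le_rpow_mul_rpow {X : Type*} [MeasurableSpace X] {μ : Measure X}
    {p p' : ℝ} (hp : p.HolderConjugate p') {F : X → ℝ≥0∞} (hF : Measurable F)
    (s : Set X) :
    ∫⁻ y in s, F y ∂μ ≤ (∫⁻ y, F y ^ p ∂μ) ^ p⁻¹ * μ s ^ p'⁻¹ := by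
  have h := ENNReal.lintegral_mul_le_Lp_mul_Lq (μ.restrict s) hp hF.aemeasurable
    (aemeasurable_const (b := (1 : ℝ≥0∞)))
  simp only [Pi.mul_apply, mul_one, ENNReal.one_rpow, lintegral_const, one_mul,
    Measure.restrict_apply_univ, one_div] at h
  refine h.trans ?_
  gcongr
  · exact inv_nonneg.2 hp.nonneg
  · exact Measure.restrict_le_self

section Sobolev

open Metric Module

variable {E : Type*} [NormedAddCommGroup E] [MeasurableSpace E]

/-- The potential `∫ F(y) |x - y|^{-lam} dy` of a nonnegative function. -/
noncomputable def lrieszPotential (μ : Measure E) (lam : ℝ) (F : E → ℝ≥0∞) (x : E) : ℝ≥0∞ :=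
  ∫⁻ y, F y * ENNReal.ofReal (‖x - y‖ ^ lam)⁻¹ ∂μ

theorem lrieszPotential_congr_ae {μ : Measure E} {lam : ℝ} {F G : E → ℝ≥0∞} (h : F =ᵐ[μ] G) :
    lrieszPotential μ lam F = lrieszPotential μ lam G := by
  ext x
  refine lintegral_congr_ae ?_
  filter_upwards [h] with y hy
  rw [hy]

/-- Equality holds for ρ > 0. At ρ = 0 the left side is 0 by the convention for inverses, hence only
an inequality. -/
theorem ofReal_inv_rpow_le_lintegral {lam ρ : ℝ} (hlam : 0 < lam) (hρ : 0 ≤ ρ) :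
    ENNReal.ofReal (ρ ^ lam)⁻¹ ≤
      ENNReal.ofReal lam * ∫⁻ r in Ioi ρ, ENNReal.ofReal (r ^ (-lam - 1)) := by
  rcases hρ.eq_or_lt with rfl | hρ
  · simp [Real.zero_rpow hlam.ne']
  · rw [lintegral_Ioi_rpow hlam hρ, ← ENNReal.ofReal_mul hlam.le, mul_div_cancel₀ _ hlam.ne',
      Real.rpow_neg hρ.le]

variable {μ : Measure E} [BorelSpace E]

theorem measurable_lrieszPotential [SecondCountableTopology E] [SFinite μ] (lam : ℝ) {F : E → ℝ≥0∞} (hF : Measurable F) :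
    Measurable (lrieszPotential μ lam F) := by
  refine Measurable.lintegral_prod_right' (f := fun z : E × E =>
    F z.2 * ENNReal.ofReal (‖z.1 - z.2‖ ^ lam)⁻¹) ?_
  fun_prop

theorem aemeasurable_lrieszPotential [SecondCountableTopology E] [SFinite μ] (lam : ℝ)
    {F : E → ℝ≥0∞} (hF : AEMeasurable F μ) : AEMeasurable (lrieszPotential μ lam F) μ := by
  rw [lrieszPotential_congr_ae hF.ae_eq_mk]
  exact (measurable_lrieszPotential lam hF.measurable_mk).aemeasurable

/-- Write the kernel as an integral over the radii r > ‖x - y‖ and exchange the integrals by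
Tonelli; the inner one becomes the mass of F in B(x, r). -/
theorem lrieszPotential_le_lintegral_ball [SFinite μ] {lam : ℝ} (hlam : 0 < lam) {F : E → ℝ≥0∞}
    (hF : Measurable F) (x : E) :
    lrieszPotential μ lam F x ≤ ENNReal.ofReal lam *
      ∫⁻ r in Ioi (0 : ℝ), ENNReal.ofReal (r ^ (-lam - 1)) * ∫⁻ y in ball x r, F y ∂μ := by
  have hmeas : Measurable (Function.uncurry fun (y : E) (r : ℝ) =>
      F y * (Ioi ‖x - y‖).indicator (fun r => ENNReal.ofReal (r ^ (-lam - 1))) r) := by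
    have hset : MeasurableSet {z : E × ℝ | ‖x - z.1‖ < z.2} :=
      measurableSet_lt (by fun_prop) (by fun_prop)
    have h1 : Measurable fun z : E × ℝ => ENNReal.ofReal (z.2 ^ (-lam - 1)) := by fun_prop
    exact (hF.comp measurable_fst).mul (h1.indicator hset)
  calc lrieszPotential μ lam F x
      ≤ ∫⁻ y, (ENNReal.ofReal lam * ∫⁻ r in Ioi (0 : ℝ),
          F y * (Ioi ‖x - y‖).indicator (fun r => ENNReal.ofReal (r ^ (-lam - 1))) r) ∂μ := by
        refine lintegral_mono fun y => ?_
        rw [lintegral_const_mul _ (Measurable.indicator (by fun_prop) measurableSet_Ioi),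
          lintegral_indicator measurableSet_Ioi, Measure.restrict_restrict measurableSet_Ioi,
          inter_eq_left.2 (Ioi_subset_Ioi (norm_nonneg _)), mul_left_comm]
        gcongr
        exact ofReal_inv_rpow_le_lintegral hlam (norm_nonneg _)
    _ = ENNReal.ofReal lam * ∫⁻ r in Ioi (0 : ℝ), ∫⁻ y,
          F y * (Ioi ‖x - y‖).indicator (fun r => ENNReal.ofReal (r ^ (-lam - 1))) r ∂μ := by
        rw [lintegral_const_mul' _ _ ENNReal.ofReal_ne_top,
          lintegral_lintegral_swap hmeas.aemeasurable]
    _ = _ := by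
        congr 2
        ext r
        rw [← lintegral_const_mul _ hF, ← lintegral_indicator measurableSet_ball]
        refine lintegral_congr fun y => ?_
        by_cases h : ‖x - y‖ < r
        · have h' : y ∈ ball x r := by rwa [mem_ball, dist_comm, dist_eq_norm]
          rw [indicator_of_mem (by exact h), indicator_of_mem h', mul_comm]
        · have h' : y ∉ ball x r := by rwa [mem_ball, dist_comm, dist_eq_norm]
          rw [indicator_of_notMem (by exact h), indicator_of_notMem h', mul_zero]

variable [NormedSpace ℝ E] [FiniteDimensional ℝ E] [μ.IsAddHaarMeasure]

/-- Splitting a radial integral of ball averages at the radius `R`. -/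
theorem lintegral_ball_split {lam p p' : ℝ} (hlam' : lam < finrank ℝ E)
    (hp : p.HolderConjugate p') (hpα : 0 < finrank ℝ E / p - (finrank ℝ E - lam))
    {F : E → ℝ≥0∞} (hF : Measurable F) (x : E) {R : ℝ} (hR : 0 < R) :
    ∫⁻ r in Ioi (0 : ℝ), ENNReal.ofReal (r ^ (-lam - 1)) * ∫⁻ y in ball x r, F y ∂μ ≤
      ballMaximal μ F x * μ (ball 0 1) *
          ENNReal.ofReal (R ^ (finrank ℝ E - lam) / (finrank ℝ E - lam)) +
        (∫⁻ y, F y ^ p ∂μ) ^ p⁻¹ * μ (ball 0 1) ^ p'⁻¹ *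
          ENNReal.ofReal (R ^ (-(finrank ℝ E / p - (finrank ℝ E - lam))) /
            (finrank ℝ E / p - (finrank ℝ E - lam))) := by
  set n := finrank ℝ E with hn
  set v := μ (ball (0 : E) 1) with hv
  have hpow (s : ℝ) : Measurable fun t : ℝ => ENNReal.ofReal (t ^ s) := by fun_prop
  rw [← Ioc_union_Ioi_eq_Ioi hR.le, lintegral_union measurableSet_Ioi (Ioc_disjoint_Ioi le_rfl)]
  refine add_le_add ?_ ?_
  -- Small radii: the mass of the ball is at most MF(x) v r^n, leaving the exponent n - lam - 1 >
  -- -1.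
  · rw [← restrict_Ioo_eq_restrict_Ioc, ← lintegral_Ioo_zero_rpow (sub_pos.2 hlam') hR.le,
      ← lintegral_const_mul _ (hpow _)]
    refine setLIntegral_mono' measurableSet_Ioo fun r hr => ?_
    calc ENNReal.ofReal (r ^ (-lam - 1)) * ∫⁻ y in ball x r, F y ∂μ
        ≤ ENNReal.ofReal (r ^ (-lam - 1)) *
          (ballMaximal μ F x * (ENNReal.ofReal (r ^ n) * v)) := by
          rw [← Measure.addHaar_ball_of_pos μ x hr.1]
          gcongr
          exact setLIntegral_ball_le_ballMaximal_mul F x hr.1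
      _ = ballMaximal μ F x * v * (ENNReal.ofReal (r ^ (-lam - 1)) * ENNReal.ofReal (r ^ n)) := by
          ring
      _ = _ := by
          rw [← ENNReal.ofReal_mul (Real.rpow_nonneg hr.1.le _), ← Real.rpow_natCast,
            ← Real.rpow_add hr.1]
          ring_nf
  -- Large radii: Hölder bounds the mass by |F|_p (v r^n)^(1/p'), and `hpα` makes the resulting
  -- power integrable at infinity.
  · rw [← lintegral_Ioi_rpow hpα hR, ← lintegral_const_mul _ (hpow _)]
    refine setLIntegral_mono' measurableSet_Ioi fun r hr => ?_
    have hr0 : 0 < r := hR.trans hr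
    have hp'0 : 0 ≤ p'⁻¹ := inv_nonneg.2 hp.symm.nonneg
    calc ENNReal.ofReal (r ^ (-lam - 1)) * ∫⁻ y in ball x r, F y ∂μ
        ≤ ENNReal.ofReal (r ^ (-lam - 1)) * ((∫⁻ y, F y ^ p ∂μ) ^ p⁻¹ *
            (ENNReal.ofReal (r ^ n) * v) ^ p'⁻¹) := by
          rw [← Measure.addHaar_ball_of_pos μ x hr0]
          gcongr
          exact setLIntegral_le_rpow_mul_rpow hp hF _
      _ = (∫⁻ y, F y ^ p ∂μ) ^ p⁻¹ * v ^ p'⁻¹ *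
            (ENNReal.ofReal (r ^ (-lam - 1)) * ENNReal.ofReal ((r ^ n) ^ p'⁻¹)) := by
          rw [ENNReal.mul_rpow_of_nonneg _ _ hp'0,
            ENNReal.ofReal_rpow_of_nonneg (by positivity) hp'0]
          ring
      _ = _ := by
          rw [← ENNReal.ofReal_mul (Real.rpow_nonneg hr0.le _), ← Real.rpow_natCast,
            ← Real.rpow_mul hr0.le, ← Real.rpow_add hr0, ← hp.one_sub_inv]
          ring_nf

/-- Hedberg's pointwise inequality. -/
theorem exists_lrieszPotential_le_ballMaximal [Nontrivial E] (μ : Measure E)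
    [μ.IsAddHaarMeasure]
    {lam p θ : ℝ} (hlam : 0 < lam) (hlam' : lam < finrank ℝ E) (hp : 1 < p)
    (hθ : θ = (finrank ℝ E - lam) * p / finrank ℝ E) (hθ1 : θ < 1) :
    ∃ C : ℝ≥0∞, C ≠ ∞ ∧ ∀ F : E → ℝ≥0∞, Measurable F → ∫⁻ y, F y ^ p ∂μ ≠ ∞ → ∀ x,
      lrieszPotential μ lam F x ≤
        C * ((∫⁻ y, F y ^ p ∂μ) ^ p⁻¹) ^ θ * ballMaximal μ F x ^ (1 - θ) := by
  have hp0 : 0 < p := one_pos.trans hp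
  have hpp : p.HolderConjugate (Real.conjExponent p) := .conjExponent hp
  set p' := Real.conjExponent p
  have hn : (0 : ℝ) < finrank ℝ E := hlam.trans hlam'
  set n := finrank ℝ E
  set v := μ (ball (0 : E) 1) with hv
  have hvt : v ≠ ∞ := measure_ball_lt_top.ne
  set α : ℝ := n - lam with hα
  have hα0 : 0 < α := sub_pos.2 hlam'
  have hθ0 : 0 < θ := by rw [hθ]; positivity
  have hs : n / p - α = n / p * (1 - θ) := by rw [hθ]; field_simp
  have hs0 : 0 < n / p - α := by rw [hs]; exact mul_pos (by positivity) (sub_pos.2 hθ1)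
  set s := n / p - α with hs'
  have hp'0 : 0 ≤ p'⁻¹ := inv_nonneg.2 hpp.symm.nonneg
  set c : ℝ≥0∞ := v * ENNReal.ofReal α⁻¹ + v ^ p'⁻¹ * ENNReal.ofReal s⁻¹ with hc
  have hct : c ≠ ∞ := by
    have := ENNReal.rpow_ne_top_of_nonneg hp'0 hvt
    rw [hc]; finiteness
  -- The added 1 makes the constant visibly nonzero, so that the right side is ∞ when the maximal
  -- function is infinite.
  refine ⟨ENNReal.ofReal lam * c + 1, by finiteness, fun F hF hN x => ?_⟩
  have hNt : (∫⁻ y, F y ^ p ∂μ) ^ p⁻¹ ≠ ∞ :=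
    ENNReal.rpow_ne_top_of_nonneg (by positivity) hN
  have key (R : ℝ) (hR : 0 < R) := lintegral_ball_split (μ := μ) hlam' hpp hs0 hF x hR
  have hle := lrieszPotential_le_lintegral_ball (μ := μ) hlam hF x
  have hzero (h : ∀ r : ℝ, 0 < r → ∫⁻ y in ball x r, F y ∂μ = 0) :
      lrieszPotential μ lam F x = 0 := by
    refine le_antisymm (hle.trans_eq ?_) zero_le
    rw [setLIntegral_congr_fun (g := fun _ => 0) measurableSet_Ioi fun r hr => by
      dsimp only; rw [h r hr, mul_zero]]
    simp
  have hA (r : ℝ) (hr : 0 < r) := setLIntegral_ball_le_ballMaximal_mul (μ := μ) F x hr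
  have hB (r : ℝ) := setLIntegral_le_rpow_mul_rpow (μ := μ) hpp hF (ball x r)
  generalize (∫⁻ y, F y ^ p ∂μ) ^ p⁻¹ = N at *
  generalize ballMaximal μ F x = A at *
  rcases eq_or_ne A 0 with rfl | hA0
  · rw [hzero fun r hr => by simpa using hA r hr]
    exact zero_le
  rcases eq_or_ne N 0 with rfl | hN0
  · rw [hzero fun r _ => by simpa using hB r]
    exact zero_le
  rcases eq_or_ne A ∞ with rfl | hAt
  · rw [ENNReal.top_rpow_of_pos (sub_pos.2 hθ1), ENNReal.mul_top]
    · exact le_top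
    · exact mul_ne_zero (by simp) (by simp [hN0, hNt])
  have ha : 0 < A.toReal := ENNReal.toReal_pos hA0 hAt
  have hm : 0 < N.toReal := ENNReal.toReal_pos hN0 hNt
  set a := A.toReal with ha'
  set m := N.toReal with hm'
  have hAa : A = ENNReal.ofReal a := (ENNReal.ofReal_toReal hAt).symm
  have hNm : N = ENNReal.ofReal m := (ENNReal.ofReal_toReal hNt).symm
  -- The balancing radius: with it both halves of the split become multiples of N^θ A^(1-θ).
  have hR0 : 0 < (m / a) ^ (p / n) := by positivity
  have h1 : A * ENNReal.ofReal (((m / a) ^ (p / n)) ^ α) = N ^ θ * A ^ (1 - θ) := by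
    rw [hAa, hNm, ENNReal.ofReal_rpow_of_pos ha, ENNReal.ofReal_rpow_of_pos hm,
      ← ENNReal.ofReal_mul ha.le, ← ENNReal.ofReal_mul (by positivity), ← Real.rpow_mul (by positivity),
      show p / n * α = θ by rw [hθ]; ring, Real.div_rpow hm.le ha.le, Real.rpow_sub ha, Real.rpow_one]
    congr 1
    ring
  have h2 : N * ENNReal.ofReal (((m / a) ^ (p / n)) ^ (-s)) = N ^ θ * A ^ (1 - θ) := by
    rw [hAa, hNm, ENNReal.ofReal_rpow_of_pos ha, ENNReal.ofReal_rpow_of_pos hm,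
      ← ENNReal.ofReal_mul hm.le, ← ENNReal.ofReal_mul (by positivity), ← Real.rpow_mul (by positivity),
      show p / n * -s = θ - 1 by rw [hs]; field_simp; ring, Real.div_rpow hm.le ha.le,
      Real.rpow_sub hm, Real.rpow_sub ha, Real.rpow_sub ha, Real.rpow_one, Real.rpow_one]
    congr 1
    field_simp
  calc lrieszPotential μ lam F x ≤ ENNReal.ofReal lam * (A * v *
          ENNReal.ofReal (((m / a) ^ (p / n)) ^ α / α) +
        N * v ^ p'⁻¹ * ENNReal.ofReal (((m / a) ^ (p / n)) ^ (-s) / s)) :=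
        hle.trans (by gcongr; exact key _ hR0)
    _ = ENNReal.ofReal lam * (A * ENNReal.ofReal (((m / a) ^ (p / n)) ^ α) *
          (v * ENNReal.ofReal α⁻¹) + N * ENNReal.ofReal (((m / a) ^ (p / n)) ^ (-s)) *
          (v ^ p'⁻¹ * ENNReal.ofReal s⁻¹)) := by
        rw [div_eq_mul_inv (_ ^ α), div_eq_mul_inv (_ ^ (-s)), ENNReal.ofReal_mul (by positivity),
          ENNReal.ofReal_mul (by positivity)]
        ring
    _ = ENNReal.ofReal lam * c * N ^ θ * A ^ (1 - θ) := by rw [h1, h2, hc]; ring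
    _ ≤ _ := by gcongr; exact le_self_add

/-- The Hardy–Littlewood–Sobolev inequality. -/
theorem exists_lintegral_lrieszPotential_rpow_le [Nontrivial E] (μ : Measure E)
    [μ.IsAddHaarMeasure]
    {lam p q : ℝ} (hlam : 0 < lam) (hlam' : lam < finrank ℝ E) (hp : 1 < p) (hq : 0 < q)
    (hpq : q⁻¹ = p⁻¹ - (finrank ℝ E - lam) / finrank ℝ E) :
    ∃ C : ℝ≥0∞, C ≠ ∞ ∧ ∀ F : E → ℝ≥0∞, Measurable F → ∫⁻ y, F y ^ p ∂μ ≠ ∞ →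
      (∫⁻ x, lrieszPotential μ lam F x ^ q ∂μ) ^ q⁻¹ ≤ C * (∫⁻ y, F y ^ p ∂μ) ^ p⁻¹ := by
  have hp0 : 0 < p := one_pos.trans hp
  have hn : (0 : ℝ) < finrank ℝ E := hlam.trans hlam'
  set θ : ℝ := (finrank ℝ E - lam) * p / finrank ℝ E with hθ
  -- Hence the q-th power of Hedberg's bound contains exactly (MF)^p.
  have hθq : 1 - θ = p * q⁻¹ := by rw [hpq, hθ]; field_simp
  have hθ1 : θ < 1 := by
    have : 0 < p * q⁻¹ := by positivity
    linarith
  have hθ0 : 0 ≤ θ := div_nonneg (mul_nonneg (sub_nonneg.2 hlam'.le) hp0.le) hn.le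
  obtain ⟨C₁, hC₁, h₁⟩ := exists_lrieszPotential_le_ballMaximal μ hlam hlam' hp hθ hθ1
  obtain ⟨C₂, hC₂, h₂⟩ := exists_lintegral_ballMaximal_rpow_le μ hp
  have hqi : 0 ≤ q⁻¹ := by positivity
  have hpi : 0 ≤ p⁻¹ := by positivity
  refine ⟨C₁ * C₂ ^ q⁻¹, ENNReal.mul_ne_top hC₁ (ENNReal.rpow_ne_top_of_nonneg hqi hC₂),
    fun F hF hN => ?_⟩
  have h₁ := h₁ F hF hN
  have h₂ := h₂ F hF
  generalize ∫⁻ y, F y ^ p ∂μ = S at *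
  have hcoef : (C₁ * (S ^ p⁻¹) ^ θ) ^ q ≠ ∞ := by
    refine ENNReal.rpow_ne_top_of_nonneg hq.le (ENNReal.mul_ne_top hC₁ ?_)
    exact ENNReal.rpow_ne_top_of_nonneg hθ0 (ENNReal.rpow_ne_top_of_nonneg hpi hN)
  calc (∫⁻ x, lrieszPotential μ lam F x ^ q ∂μ) ^ q⁻¹
      ≤ (∫⁻ x, (C₁ * (S ^ p⁻¹) ^ θ) ^ q * ballMaximal μ F x ^ p ∂μ) ^ q⁻¹ := by
        gcongr with x
        refine (ENNReal.rpow_le_rpow (h₁ x) hq.le).trans_eq ?_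
        rw [ENNReal.mul_rpow_of_nonneg _ _ hq.le, ← ENNReal.rpow_mul (ballMaximal μ F x), hθq,
          mul_assoc, inv_mul_cancel₀ hq.ne', mul_one]
    _ ≤ ((C₁ * (S ^ p⁻¹) ^ θ) ^ q * (C₂ * S)) ^ q⁻¹ := by
        rw [lintegral_const_mul' _ _ hcoef]
        gcongr
    _ = C₁ * C₂ ^ q⁻¹ * ((S ^ p⁻¹) ^ θ * S ^ q⁻¹) := by
        rw [ENNReal.mul_rpow_of_nonneg _ _ hqi, ENNReal.rpow_rpow_inv hq.ne',
          ENNReal.mul_rpow_of_nonneg _ _ hqi]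
        ring
    _ = C₁ * C₂ ^ q⁻¹ * S ^ p⁻¹ := by
        rw [← ENNReal.rpow_mul, ← ENNReal.rpow_add_of_nonneg _ _ (by positivity) hqi]
        congr 2
        have : q⁻¹ = p⁻¹ * (1 - θ) := by rw [hθq]; field_simp
        rw [this]; ring

end Sobolev

/-! ### Exponents -/

section Exponents

variable {d : ℕ} {α : ℝ}

theorem ofReal_div_le_inv (hα : 0 < α) (hαd : α < d) {p : ℝ≥0∞}
    (hp : p ≤ ENNReal.ofReal (d / α)) : ENNReal.ofReal (α / d) ≤ p⁻¹ := by
  have hd : (0 : ℝ) < d := hα.trans hαd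
  rw [← inv_div, ENNReal.ofReal_inv_of_pos (by positivity), ENNReal.inv_le_inv]
  exact hp

/-- Subtraction in `ℝ≥0∞` is truncated; p ≤ d/α makes it genuine. -/
theorem exponentP_exponentQ (hα : 0 < α) (hαd : α < d) {p : ℝ≥0∞}
    (hp : p ≤ ENNReal.ofReal (d / α)) : exponentP d α (exponentQ d α p) = p := by
  rw [exponentP, exponentQ, inv_inv, tsub_add_cancel_of_le (ofReal_div_le_inv hα hαd hp), inv_inv]

theorem exponentQ_exponentP (q : ℝ≥0∞) : exponentQ d α (exponentP d α q) = q := by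
  rw [exponentQ, exponentP, inv_inv, ENNReal.add_sub_cancel_right ENNReal.ofReal_ne_top, inv_inv]

theorem exponentP_mem_Ioo (hα : 0 < α) (hαd : α < d) {s₁ s₂ q : ℝ≥0∞}
    (hs₂ : s₂ ≤ ENNReal.ofReal (d / α)) (hq : q ∈ Ioo (exponentQ d α s₁) (exponentQ d α s₂)) :
    exponentP d α q ∈ Ioo s₁ s₂ := by
  obtain ⟨h₁, h₂⟩ := hq
  rw [exponentQ, ENNReal.inv_lt_iff_inv_lt] at h₁
  rw [exponentQ, ENNReal.lt_inv_iff_lt_inv] at h₂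
  constructor
  · rw [exponentP, ENNReal.lt_inv_iff_lt_inv]
    exact lt_tsub_iff_right.1 h₁
  · rw [exponentP, ENNReal.inv_lt_iff_inv_lt]
    exact (ENNReal.sub_lt_iff_lt_right ENNReal.ofReal_ne_top (ofReal_div_le_inv hα hαd hs₂)).1 h₂

theorem exponentQ_mem_Ioo (hα : 0 < α) (hαd : α < d) {s₁ s₂ p : ℝ≥0∞}
    (hs₂ : s₂ ≤ ENNReal.ofReal (d / α)) (hp : p ∈ Ioo s₁ s₂) :
    exponentQ d α p ∈ Ioo (exponentQ d α s₁) (exponentQ d α s₂) := by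
  constructor
  · rw [exponentQ, exponentQ, ENNReal.inv_lt_inv]
    exact ((ENNReal.cancel_of_ne ENNReal.ofReal_ne_top).tsub_lt_tsub_iff_right
      (ofReal_div_le_inv hα hαd (hp.2.le.trans hs₂))).2 (ENNReal.inv_lt_inv.2 hp.1)
  · rw [exponentQ, exponentQ, ENNReal.inv_lt_inv]
    exact ((ENNReal.cancel_of_ne ENNReal.ofReal_ne_top).tsub_lt_tsub_iff_right
      (ofReal_div_le_inv hα hαd hs₂)).2 (ENNReal.inv_lt_inv.2 hp.2)

theorem exponentQ_toReal (hα : 0 < α) (hαd : α < d) {p : ℝ≥0∞} (hp1 : 1 < p)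
    (hp : p < ENNReal.ofReal (d / α)) :
    0 < (exponentQ d α p).toReal ∧ (exponentQ d α p).toReal⁻¹ = p.toReal⁻¹ - α / d := by
  have hd : (0 : ℝ) < d := hα.trans hαd
  have hp0 : p ≠ 0 := (zero_lt_one.trans hp1).ne'
  have hpt : p ≠ ∞ := hp.ne_top
  have hle := ofReal_div_le_inv hα hαd hp.le
  have hq : (exponentQ d α p).toReal⁻¹ = p.toReal⁻¹ - α / d := by
    rw [exponentQ, ENNReal.toReal_inv, inv_inv,
      ENNReal.toReal_sub_of_le hle (by simpa using hp0), ENNReal.toReal_inv,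
      ENNReal.toReal_ofReal (by positivity)]
  refine ⟨inv_pos.1 ?_, hq⟩
  have h1 : p.toReal < d / α := (ENNReal.lt_ofReal_iff_toReal_lt hpt).1 hp
  rw [hq, sub_pos, ← inv_div]
  exact inv_strictAnti₀ (ENNReal.toReal_pos hp0 hpt) h1

end Exponents

/-! ### Riesz potentials -/

section Potential

variable {d : ℕ} {α : ℝ} {f g : EuclideanSpace ℝ (Fin d) → ℝ}

theorem enorm_rieszIntegrand (f : EuclideanSpace ℝ (Fin d) → ℝ) (x y : EuclideanSpace ℝ (Fin d)) :
    ‖rieszIntegrand α f x y‖ₑ = ‖f y‖ₑ * ENNReal.ofReal (‖x - y‖ ^ ((d : ℝ) - α))⁻¹ := by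
  rw [rieszIntegrand, div_eq_mul_inv, enorm_mul,
    Real.enorm_of_nonneg (r := (‖x - y‖ ^ ((d : ℝ) - α))⁻¹) (by positivity)]

theorem enorm_rieszPotential_le (f : EuclideanSpace ℝ (Fin d) → ℝ)
    (x : EuclideanSpace ℝ (Fin d)) :
    ‖rieszPotential α f x‖ₑ ≤ lrieszPotential volume ((d : ℝ) - α) (fun y => ‖f y‖ₑ) x := by
  refine (enorm_integral_le_lintegral_enorm _).trans_eq ?_
  simp only [enorm_rieszIntegrand, lrieszPotential]

theorem rieszPotential_congr_ae (h : f =ᵐ[volume] g) :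
    rieszPotential α f = rieszPotential α g := by
  ext x
  refine integral_congr_ae ?_
  filter_upwards [h] with y hy
  rw [rieszIntegrand, rieszIntegrand, hy]

theorem aestronglyMeasurable_rieszIntegrand (hf : AEStronglyMeasurable f volume)
    (x : EuclideanSpace ℝ (Fin d)) : AEStronglyMeasurable (rieszIntegrand α f x) volume := by
  have : Measurable fun y : EuclideanSpace ℝ (Fin d) => (‖x - y‖ ^ ((d : ℝ) - α))⁻¹ := by fun_prop
  exact (hf.mul this.aestronglyMeasurable).congr
    (Filter.Eventually.of_forall fun y => (div_eq_mul_inv _ _).symm)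

theorem aestronglyMeasurable_rieszPotential (hf : AEStronglyMeasurable f volume) :
    AEStronglyMeasurable (rieszPotential α f) volume := by
  rw [rieszPotential_congr_ae hf.ae_eq_mk]
  have hm : Measurable (hf.mk f) := hf.stronglyMeasurable_mk.measurable
  have : Measurable fun z : EuclideanSpace ℝ (Fin d) × EuclideanSpace ℝ (Fin d) =>
      rieszIntegrand α (hf.mk f) z.1 z.2 := by
    unfold rieszIntegrand
    fun_prop
  exact this.stronglyMeasurable.integral_prod_right'.aestronglyMeasurable

theorem integrable_rieszIntegrand_iff (hf : AEStronglyMeasurable f volume)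
    (x : EuclideanSpace ℝ (Fin d)) : Integrable (rieszIntegrand α f x) ↔
      lrieszPotential volume ((d : ℝ) - α) (fun y => ‖f y‖ₑ) x < ∞ := by
  rw [Integrable, hasFiniteIntegral_iff_enorm]
  simp only [enorm_rieszIntegrand, lrieszPotential, aestronglyMeasurable_rieszIntegrand hf x,
    true_and]

/-- Integrability matters: without it the Bochner integral is 0 by convention while the potential on
the right is infinite. -/
theorem enorm_rieszPotential_of_nonneg (hf : 0 ≤ f) {x : EuclideanSpace ℝ (Fin d)}
    (hx : Integrable (rieszIntegrand α f x)) :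
    ‖rieszPotential α f x‖ₑ = lrieszPotential volume ((d : ℝ) - α) (fun y => ‖f y‖ₑ) x := by
  have h0 : ∀ y, 0 ≤ rieszIntegrand α f x y := fun y =>
    div_nonneg (hf y) (by positivity)
  rw [rieszPotential, Real.enorm_of_nonneg (integral_nonneg h0),
    ofReal_integral_eq_lintegral_ofReal hx (Filter.Eventually.of_forall h0)]
  simp only [← Real.enorm_of_nonneg (h0 _), enorm_rieszIntegrand, lrieszPotential]

/-- The kernel is positive off y = x, and a point is null. -/
theorem ae_eq_zero_of_lrieszPotential_eq_zero (hα : 0 < α) (hαd : α < d)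
    {F : EuclideanSpace ℝ (Fin d) → ℝ≥0∞} (hF : AEMeasurable F volume)
    {x : EuclideanSpace ℝ (Fin d)} (hx : lrieszPotential volume ((d : ℝ) - α) F x = 0) :
    F =ᵐ[volume] 0 := by
  have : Nonempty (Fin d) := ⟨⟨0, by exact_mod_cast hα.trans hαd⟩⟩
  rw [lrieszPotential, lintegral_eq_zero_iff' (by fun_prop)] at hx
  filter_upwards [hx, Measure.ae_ne volume x] with y hy hyx
  refine (mul_eq_zero.1 hy).resolve_right ?_
  have : 0 < ‖x - y‖ := norm_pos_iff.2 (sub_ne_zero.2 hyx.symm)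
  simpa using Real.rpow_pos_of_pos this _

variable {p : ℝ≥0∞}

theorem exists_eLpNorm_lrieszPotential_le (hα : 0 < α) (hαd : α < d) (hp1 : 1 < p)
    (hp : p < ENNReal.ofReal (d / α)) :
    ∃ C : ℝ≥0∞, C ≠ ∞ ∧ ∀ f : EuclideanSpace ℝ (Fin d) → ℝ, MemLp f p volume →
      eLpNorm (lrieszPotential volume ((d : ℝ) - α) fun y => ‖f y‖ₑ) (exponentQ d α p) volume ≤
        C * eLpNorm f p volume := by
  have : Nonempty (Fin d) := ⟨⟨0, by exact_mod_cast hα.trans hαd⟩⟩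
  obtain ⟨hq0, hq⟩ := exponentQ_toReal hα hαd hp1 hp
  have hp0 : p ≠ 0 := (zero_lt_one.trans hp1).ne'
  have hpt : p ≠ ∞ := hp.ne_top
  have hp1' : 1 < p.toReal := by
    simpa using (ENNReal.toReal_lt_toReal ENNReal.one_ne_top hpt).2 hp1
  obtain ⟨hq0', hqt⟩ := ENNReal.toReal_pos_iff.1 hq0
  obtain ⟨C, hC, h⟩ := exists_lintegral_lrieszPotential_rpow_le
    (volume : Measure (EuclideanSpace ℝ (Fin d))) (lam := d - α) (sub_pos.2 hαd) (by simpa using hα)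
    hp1' hq0 (by simpa using hq)
  refine ⟨C, hC, fun f hf => ?_⟩
  obtain ⟨g, hg, hfg⟩ := hf.1
  have hgp : MemLp g p volume := hf.ae_eq hfg
  have h := h (fun y => ‖g y‖ₑ) hg.measurable.enorm
    (lintegral_rpow_enorm_lt_top_of_eLpNorm_lt_top hp0 hpt hgp.2).ne
  rw [lrieszPotential_congr_ae (F := fun y => ‖f y‖ₑ) (G := fun y => ‖g y‖ₑ)
      (hfg.fun_comp (‖·‖ₑ)), eLpNorm_congr_ae hfg,
    eLpNorm_eq_lintegral_rpow_enorm_toReal hq0'.ne' hqt.ne,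
    eLpNorm_eq_lintegral_rpow_enorm_toReal hp0 hpt, one_div, one_div]
  simpa only [enorm_eq_self] using h

theorem ae_integrable_rieszIntegrand (hα : 0 < α) (hαd : α < d) (hp1 : 1 < p)
    (hp : p < ENNReal.ofReal (d / α)) (hf : MemLp f p volume) :
    ∀ᵐ x, Integrable (rieszIntegrand α f x) := by
  obtain ⟨C, hC, h⟩ := exists_eLpNorm_lrieszPotential_le hα hαd hp1 hp
  obtain ⟨hq0, -⟩ := exponentQ_toReal hα hαd hp1 hp
  obtain ⟨hq0', hqt⟩ := ENNReal.toReal_pos_iff.1 hq0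
  have hlt := (h f hf).trans_lt (ENNReal.mul_lt_top hC.lt_top hf.2)
  have hfin := lintegral_rpow_enorm_lt_top_of_eLpNorm_lt_top hq0'.ne' hqt.ne hlt
  have hpot := aemeasurable_lrieszPotential ((d : ℝ) - α) hf.1.enorm
  simp only [enorm_eq_self] at hfin
  filter_upwards [ae_lt_top' (hpot.pow_const _) hfin.ne] with x hx
  rw [integrable_rieszIntegrand_iff hf.1]
  exact (ENNReal.rpow_lt_top_iff_of_pos hq0).1 hx

theorem exists_eLpNorm_rieszPotential_le (hα : 0 < α) (hαd : α < d) (hp1 : 1 < p)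
    (hp : p < ENNReal.ofReal (d / α)) :
    ∃ C : ℝ≥0∞, C ≠ ∞ ∧ ∀ f : EuclideanSpace ℝ (Fin d) → ℝ, MemLp f p volume →
      eLpNorm (rieszPotential α f) (exponentQ d α p) volume ≤ C * eLpNorm f p volume := by
  obtain ⟨C, hC, h⟩ := exists_eLpNorm_lrieszPotential_le hα hαd hp1 hp
  exact ⟨C, hC, fun f hf =>
    (eLpNorm_mono_enorm fun x => enorm_rieszPotential_le f x).trans (h f hf)⟩

theorem rieszConstant_lt_top (hα : 0 < α) (hαd : α < d) (hp1 : 1 < p)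
    (hp : p < ENNReal.ofReal (d / α)) : rieszConstant d α p < ∞ := by
  obtain ⟨C, hC, h⟩ := exists_eLpNorm_rieszPotential_le hα hαd hp1 hp
  refine lt_of_le_of_lt (iSup_le fun f => iSup₂_le fun hf _ => ?_) hC.lt_top
  exact ENNReal.div_le_of_le_mul (h f hf)

theorem eLpNorm_rieszPotential_le (hα : 0 < α) (hαd : α < d) (hp1 : 1 < p)
    (hp : p < ENNReal.ofReal (d / α)) (hf : MemLp f p volume) :
    eLpNorm (rieszPotential α f) (exponentQ d α p) volume ≤
      rieszConstant d α p * eLpNorm f p volume := by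
  rcases eq_or_ne (eLpNorm f p volume) 0 with h0 | h0
  -- Functions of norm 0 are excluded from the supremum, so the Sobolev bound covers them.
  · obtain ⟨C, -, h⟩ := exists_eLpNorm_rieszPotential_le hα hαd hp1 hp
    simpa [h0] using h f hf
  · rw [← ENNReal.div_le_iff h0 hf.2.ne]
    exact le_iSup_of_le f (le_iSup₂_of_le hf h0 le_rfl)

theorem ae_enorm_rieszPotential_of_nonneg (hα : 0 < α) (hαd : α < d) (hp1 : 1 < p)
    (hp : p < ENNReal.ofReal (d / α)) (hf : MemLp f p volume) (h0 : 0 ≤ f) :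
    ∀ᵐ x, ‖rieszPotential α f x‖ₑ =
      lrieszPotential volume ((d : ℝ) - α) (fun y => ‖f y‖ₑ) x := by
  filter_upwards [ae_integrable_rieszIntegrand hα hαd hp1 hp hf] with x hx
  exact enorm_rieszPotential_of_nonneg h0 hx

/-- If K(p) were 0, the potential of the indicator of the unit ball would vanish almost everywhere,
forcing that indicator to vanish almost everywhere. -/
theorem rieszConstant_pos (hα : 0 < α) (hαd : α < d) (hp1 : 1 < p)
    (hp : p < ENNReal.ofReal (d / α)) : 0 < rieszConstant d α p := by
  obtain ⟨hq0, -⟩ := exponentQ_toReal hα hαd hp1 hp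
  obtain ⟨hq0', -⟩ := ENNReal.toReal_pos_iff.1 hq0
  have hp0 : p ≠ 0 := (zero_lt_one.trans hp1).ne'
  let f : EuclideanSpace ℝ (Fin d) → ℝ := (Metric.ball 0 1).indicator fun _ => 1
  have hf : MemLp f p volume :=
    memLp_indicator_const p measurableSet_ball 1 (Or.inr measure_ball_lt_top.ne)
  have hfnn : 0 ≤ f := fun x => indicator_nonneg (fun _ _ => zero_le_one) x
  have hf0 : ¬ f =ᵐ[volume] 0 := by
    intro h
    have hv := (Metric.measure_ball_pos volume (0 : EuclideanSpace ℝ (Fin d)) one_pos).ne'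
    rw [indicator_ae_eq_zero] at h
    simp [Function.support_const, hv] at h
  by_contra! hK
  have hle := eLpNorm_rieszPotential_le hα hαd hp1 hp hf
  rw [nonpos_iff_eq_zero.1 hK, zero_mul, nonpos_iff_eq_zero, eLpNorm_eq_zero_iff
    (aestronglyMeasurable_rieszPotential hf.1) hq0'.ne'] at hle
  obtain ⟨x, hx0, hx⟩ :=
    (hle.and (ae_enorm_rieszPotential_of_nonneg hα hαd hp1 hp hf hfnn)).exists
  rw [hx0, Pi.zero_apply, enorm_zero] at hx
  have h := ae_eq_zero_of_lrieszPotential_eq_zero hα hαd hf.1.enorm hx.symm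
  refine hf0 ?_
  filter_upwards [h] with y hy
  simpa using hy

end Potential

/-! ### Continuity of the `L_p` norm in the exponent -/

section Continuity

variable {X : Type*} [MeasurableSpace X] {μ : Measure X}

theorem memLp_of_norm_le_indicator {g : X → ℝ} (hg : AEStronglyMeasurable g μ) {s : Set X}
    (hs : MeasurableSet s) (hμs : μ s ≠ ∞) {M : ℝ} (hgM : ∀ x, ‖g x‖ ≤ s.indicator (fun _ => M) x)
    (r : ℝ≥0∞) : MemLp g r μ :=
  (memLp_indicator_const r hs M (Or.inr hμs)).mono' hg (Filter.Eventually.of_forall hgM)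

/-- Dominated convergence. The endpoints are included so that compactness can later supply a lower
bound; the maximum with 1 makes the dominating power increase with the exponent. -/
theorem continuousOn_eLpNorm {g : X → ℝ} (hg : AEStronglyMeasurable g μ) {s : Set X}
    (hs : MeasurableSet s) (hμs : μ s ≠ ∞) {M : ℝ} (hgM : ∀ x, ‖g x‖ ≤ s.indicator (fun _ => M) x)
    {b : ℝ≥0∞} (hb : b ≠ ∞) : ContinuousOn (fun r : ℝ≥0∞ => eLpNorm g r μ) (Icc 1 b) := by
  have hI : ContinuousOn (fun t : ℝ => ∫ x, ‖g x‖ ^ t ∂μ) (Icc 1 b.toReal) := by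
    refine continuousOn_of_dominated (bound := s.indicator fun _ => (max M 1) ^ b.toReal)
      (fun t ht => ?_) (fun t ht => Filter.Eventually.of_forall fun x => ?_) ?_
      (Filter.Eventually.of_forall fun x => ?_)
    · exact (hg.norm.aemeasurable.pow_const t).aestronglyMeasurable
    · have ht0 : 0 < t := one_pos.trans_le ht.1
      rw [Real.norm_of_nonneg (by positivity)]
      have h := hgM x
      by_cases hx : x ∈ s
      · rw [indicator_of_mem hx] at h ⊢
        calc ‖g x‖ ^ t ≤ (max M 1) ^ t := by
              gcongr
              exact h.trans (le_max_left _ _)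
          _ ≤ _ := Real.rpow_le_rpow_of_exponent_le (le_max_right _ _) ht.2
      · rw [indicator_of_notMem hx] at h ⊢
        rw [le_antisymm h (norm_nonneg _), Real.zero_rpow ht0.ne']
    · exact (integrable_indicator_iff hs).2 (integrableOn_const hμs)
    · intro t ht
      exact (Real.continuousAt_const_rpow' (one_pos.trans_le ht.1).ne').continuousWithinAt
  have hJ : ContinuousOn (fun t : ℝ => ENNReal.ofReal ((∫ x, ‖g x‖ ^ t ∂μ) ^ t⁻¹))
      (Icc 1 b.toReal) := by
    refine ENNReal.continuous_ofReal.comp_continuousOn (hI.rpow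
      (continuousOn_id.inv₀ fun t ht => (one_pos.trans_le ht.1).ne') fun t ht => Or.inr ?_)
    exact inv_pos.2 (one_pos.trans_le ht.1)
  have hne : ∀ r ∈ Icc 1 b, r ≠ ∞ := fun r hr => ne_top_of_le_ne_top hb hr.2
  have hmaps : MapsTo ENNReal.toReal (Icc 1 b) (Icc 1 b.toReal) := fun r hr =>
    ⟨by simpa using ENNReal.toReal_mono (hne r hr) hr.1, ENNReal.toReal_mono hb hr.2⟩
  refine (hJ.comp (ENNReal.continuousOn_toReal.mono hne) hmaps).congr fun r hr => ?_
  exact (memLp_of_norm_le_indicator hg hs hμs hgM r).eLpNorm_eq_integral_rpow_norm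
    (zero_lt_one.trans_le hr.1).ne' (hne r hr)

/-- Supplies the weight for sharpness. The minimum over the compact interval is attained, and it is
positive since `g` is not null. -/
theorem isPsiFunction_eLpNorm {g : X → ℝ} (hg : AEStronglyMeasurable g μ) {s : Set X}
    (hs : MeasurableSet s) (hμs : μ s ≠ ∞) {M : ℝ} (hgM : ∀ x, ‖g x‖ ≤ s.indicator (fun _ => M) x)
    (hg0 : ¬ g =ᵐ[μ] 0) {s₁ s₂ : ℝ≥0∞} (hs₁ : 1 ≤ s₁) (h₁₂ : s₁ ≤ s₂) (hs₂ : s₂ ≠ ∞) :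
    IsPsiFunction (fun r => eLpNorm g r μ) s₁ s₂ := by
  have hcont : ContinuousOn (fun r : ℝ≥0∞ => eLpNorm g r μ) (Icc s₁ s₂) :=
    (continuousOn_eLpNorm hg hs hμs hgM hs₂).mono (Icc_subset_Icc_left hs₁)
  refine ⟨hcont.mono Ioo_subset_Icc_self,
    fun r _ => (memLp_of_norm_le_indicator hg hs hμs hgM r).2.ne, ?_⟩
  obtain ⟨r, hr, hmin⟩ := isCompact_Icc.exists_isMinOn (nonempty_Icc.2 h₁₂) hcont
  refine ⟨eLpNorm g r μ, pos_iff_ne_zero.2 fun h => hg0 ?_,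
    fun q hq => hmin (Ioo_subset_Icc_self hq)⟩
  exact (eLpNorm_eq_zero_iff hg (zero_lt_one.trans_le (hs₁.trans hr.1)).ne').1 h

end Continuity

/-! ### Grand Lebesgue spaces -/

section Grand

variable {d : ℕ} {α : ℝ}

/-- The truncation of `|f|` to the part of the ball of radius `n` where `|f| ≤ n`. -/
noncomputable def normTruncation (f : EuclideanSpace ℝ (Fin d) → ℝ) (n : ℕ) : EuclideanSpace ℝ (Fin d) → ℝ :=
  (Metric.ball 0 n ∩ {x | ‖f x‖ ≤ n}).indicator fun x => ‖f x‖

variable (f : EuclideanSpace ℝ (Fin d) → ℝ)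

theorem normTruncation_nonneg (n : ℕ) : 0 ≤ normTruncation f n :=
  fun x => indicator_nonneg (fun _ _ => norm_nonneg _) x

theorem norm_normTruncation_le (n : ℕ) (x : EuclideanSpace ℝ (Fin d)) :
    ‖normTruncation f n x‖ ≤ (Metric.ball 0 (n : ℝ)).indicator (fun _ => (n : ℝ)) x := by
  rw [normTruncation, Real.norm_of_nonneg (indicator_nonneg (fun _ _ => norm_nonneg _) x)]
  by_cases hx : x ∈ Metric.ball 0 (n : ℝ) ∩ {x | ‖f x‖ ≤ n}
  · rw [indicator_of_mem hx, indicator_of_mem hx.1]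
    exact hx.2
  · rw [indicator_of_notMem hx]
    exact indicator_nonneg (fun _ _ => by positivity) x

theorem norm_normTruncation_le_norm (n : ℕ) (x : EuclideanSpace ℝ (Fin d)) :
    ‖normTruncation f n x‖ ≤ ‖f x‖ := by
  rw [normTruncation, Real.norm_of_nonneg (indicator_nonneg (fun _ _ => norm_nonneg _) x)]
  exact indicator_le_self' (fun _ _ => norm_nonneg _) x

theorem monotone_enorm_normTruncation (x : EuclideanSpace ℝ (Fin d)) :
    Monotone fun n => ‖normTruncation f n x‖ₑ := by
  intro m n hmn
  have hmn' : (m : ℝ) ≤ n := by exact_mod_cast hmn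
  refine enorm_le_iff_norm_le.2 ?_
  rw [Real.norm_of_nonneg (normTruncation_nonneg f m x),
    Real.norm_of_nonneg (normTruncation_nonneg f n x)]
  refine indicator_le_indicator_of_subset ?_ (fun _ => norm_nonneg _) x
  exact inter_subset_inter (Metric.ball_subset_ball hmn') fun y hy => le_trans hy hmn'

theorem tendsto_enorm_normTruncation (x : EuclideanSpace ℝ (Fin d)) :
    Filter.Tendsto (fun n => ‖normTruncation f n x‖ₑ) Filter.atTop (nhds ‖f x‖ₑ) := by
  obtain ⟨N, hN⟩ := exists_nat_gt (max ‖x‖ ‖f x‖)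
  refine tendsto_const_nhds.congr' ?_
  filter_upwards [Filter.eventually_ge_atTop N] with n hn
  have hn' : max ‖x‖ ‖f x‖ < n := hN.trans_le (by exact_mod_cast hn)
  have hx : x ∈ Metric.ball 0 (n : ℝ) ∩ {x | ‖f x‖ ≤ n} :=
    ⟨mem_ball_zero_iff.2 ((le_max_left _ _).trans_lt hn'), ((le_max_right _ _).trans_lt hn').le⟩
  rw [normTruncation, indicator_of_mem hx, enorm_norm]

variable {f}

theorem measurable_normTruncation (hf : Measurable f) (n : ℕ) : Measurable (normTruncation f n) :=
  hf.norm.indicator (measurableSet_ball.inter (measurableSet_le hf.norm measurable_const))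

theorem tendsto_lrieszPotential_normTruncation (lam : ℝ) (hf : Measurable f)
    (x : EuclideanSpace ℝ (Fin d)) :
    Filter.Tendsto (fun n => lrieszPotential volume lam (fun y => ‖normTruncation f n y‖ₑ) x)
      Filter.atTop (nhds (lrieszPotential volume lam (fun y => ‖f y‖ₑ) x)) := by
  refine lintegral_tendsto_of_tendsto_of_monotone (fun n => ?_)
    (Filter.Eventually.of_forall fun y m n hmn => ?_) (Filter.Eventually.of_forall fun y => ?_)
  · have := measurable_normTruncation hf n
    fun_prop
  · exact mul_le_mul_left (monotone_enorm_normTruncation f y hmn) _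
  · exact ENNReal.Tendsto.mul_const (tendsto_enorm_normTruncation f y)
      (Or.inr ENNReal.ofReal_ne_top)

theorem tendsto_eLpNorm_lrieszPotential_normTruncation (lam : ℝ) (hf : Measurable f) {q : ℝ≥0∞}
    (hq0 : q ≠ 0) (hqt : q ≠ ∞) :
    Filter.Tendsto
      (fun n => eLpNorm (lrieszPotential volume lam fun y => ‖normTruncation f n y‖ₑ) q volume)
      Filter.atTop (nhds (eLpNorm (lrieszPotential volume lam fun y => ‖f y‖ₑ) q volume)) := by
  simp only [eLpNorm_eq_lintegral_rpow_enorm_toReal hq0 hqt, enorm_eq_self]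
  refine (ENNReal.continuous_rpow_const.tendsto _).comp
    (lintegral_tendsto_of_tendsto_of_monotone (fun n => ?_)
      (Filter.Eventually.of_forall fun x m n hmn => ?_) (Filter.Eventually.of_forall fun x => ?_))
  · exact ((measurable_lrieszPotential lam
      (measurable_normTruncation hf n).enorm).pow_const _).aemeasurable
  · refine ENNReal.rpow_le_rpow (lintegral_mono fun y => ?_) ENNReal.toReal_nonneg
    exact mul_le_mul_left (monotone_enorm_normTruncation f y hmn) _
  · exact (ENNReal.continuous_rpow_const.tendsto _).comp
      (tendsto_lrieszPotential_normTruncation lam hf x)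

/-- The supremum defining `rieszConstant` is approached by bounded functions of bounded support. -/
theorem exists_bounded_lt_eLpNorm_rieszPotential (hα : 0 < α) (hαd : α < d) {p : ℝ≥0∞}
    (hp1 : 1 < p) (hp : p < ENNReal.ofReal (d / α)) {c : ℝ≥0∞} (hc : c < rieszConstant d α p) :
    ∃ (g : EuclideanSpace ℝ (Fin d) → ℝ) (n : ℕ), Measurable g ∧
      (∀ x, ‖g x‖ ≤ (Metric.ball 0 (n : ℝ)).indicator (fun _ => (n : ℝ)) x) ∧
      c * eLpNorm g p volume < eLpNorm (rieszPotential α g) (exponentQ d α p) volume := by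
  obtain ⟨hq0, -⟩ := exponentQ_toReal hα hαd hp1 hp
  obtain ⟨hq0', hqt⟩ := ENNReal.toReal_pos_iff.1 hq0
  simp only [rieszConstant, lt_iSup_iff] at hc
  obtain ⟨f₀, hf₀, h0, hc⟩ := hc
  rw [ENNReal.lt_div_iff_mul_lt (Or.inl h0) (Or.inl hf₀.2.ne)] at hc
  obtain ⟨f, hfm, hff⟩ := hf₀.1
  rw [rieszPotential_congr_ae hff, eLpNorm_congr_ae hff] at hc
  have hf : MemLp f p volume := hf₀.ae_eq hff
  have hfm := hfm.measurable
  have hlt := hc.trans_le (eLpNorm_mono_enorm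
    (g := lrieszPotential volume ((d : ℝ) - α) fun y => ‖f y‖ₑ)
    fun x => enorm_rieszPotential_le f x)
  -- Passing to |f| only raises the numerator. By monotone convergence some truncation keeps the
  -- strict inequality, while its L_p norm is no larger.
  obtain ⟨n, hn⟩ := ((tendsto_eLpNorm_lrieszPotential_normTruncation _ hfm hq0'.ne'
    hqt.ne).eventually_const_lt hlt).exists
  have hle : eLpNorm (normTruncation f n) p volume ≤ eLpNorm f p volume :=
    eLpNorm_mono (norm_normTruncation_le_norm f n)
  have hmem : MemLp (normTruncation f n) p volume :=
    ⟨(measurable_normTruncation hfm n).aestronglyMeasurable, hle.trans_lt hf.2⟩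
  refine ⟨normTruncation f n, n, measurable_normTruncation hfm n, norm_normTruncation_le f n, ?_⟩
  refine (mul_le_mul_right hle c).trans_lt (hn.trans_eq (eLpNorm_congr_enorm_ae ?_))
  filter_upwards [ae_enorm_rieszPotential_of_nonneg hα hαd hp1 hp hmem
    (normTruncation_nonneg f n)] with x hx
  rw [hx, enorm_eq_self]

theorem MemGrandLebesgue.memLp {ψ : ℝ≥0∞ → ℝ≥0∞} {s₁ s₂ : ℝ≥0∞} (hψ : IsPsiFunction ψ s₁ s₂)
    (hf : MemGrandLebesgue ψ s₁ s₂ f) {p : ℝ≥0∞} (hp : p ∈ Ioo s₁ s₂) : MemLp f p volume := by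
  refine ⟨hf.1, ?_⟩
  have h : eLpNorm f p volume / ψ p < ∞ :=
    lt_of_le_of_lt (le_iSup₂ (f := fun q (_ : q ∈ Ioo s₁ s₂) => eLpNorm f q volume / ψ q) p hp) hf.2
  by_contra! htop
  rw [top_le_iff.1 htop, ENNReal.top_div_of_ne_top (hψ.ne_top p hp)] at h
  exact lt_irrefl _ h

theorem grandLebesgueNorm_rieszPotential_le (hα : 0 < α) (hαd : α < d) {s₁ s₂ : ℝ≥0∞}
    (hs₁ : 1 ≤ s₁) (hs₂ : s₂ ≤ ENNReal.ofReal (d / α)) {ψ : ℝ≥0∞ → ℝ≥0∞}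
    (hψ : IsPsiFunction ψ s₁ s₂) (hf : MemGrandLebesgue ψ s₁ s₂ f) :
    grandLebesgueNorm (psiK d α ψ) (exponentQ d α s₁) (exponentQ d α s₂) (rieszPotential α f) ≤
      grandLebesgueNorm ψ s₁ s₂ f := by
  refine iSup₂_le fun q hq => ?_
  have hp := exponentP_mem_Ioo hα hαd hs₂ hq
  have hp1 := hs₁.trans_lt hp.1
  have hp2 := hp.2.trans_le hs₂
  have h := eLpNorm_rieszPotential_le hα hαd hp1 hp2 (hf.memLp hψ hp)
  rw [exponentQ_exponentP] at h
  refine le_trans ?_ (le_iSup₂ (f := fun q (_ : q ∈ Ioo s₁ s₂) => eLpNorm f q volume / ψ q) _ hp)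
  calc eLpNorm (rieszPotential α f) q volume / psiK d α ψ q
      ≤ rieszConstant d α (exponentP d α q) * eLpNorm f (exponentP d α q) volume /
          (rieszConstant d α (exponentP d α q) * ψ (exponentP d α q)) := ENNReal.div_le_div_right h _
    _ = _ := ENNReal.mul_div_mul_left _ _ (rieszConstant_pos hα hαd hp1 hp2).ne'
        (rieszConstant_lt_top hα hαd hp1 hp2).ne

/-- If C < 1, then C K(p) < K(p), so some bounded `g` has ratio above C K(p). With ψ(r) = |g|_r the
term at q(p) is that ratio divided by K(p), hence above C, while ‖g‖ ≤ 1. -/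
theorem one_le_of_grandLebesgueNorm_rieszPotential_le (hα : 0 < α) (hαd : α < d) {s₁ s₂ : ℝ≥0∞}
    (hs₁ : 1 ≤ s₁) (hs : s₁ < s₂) (hs₂ : s₂ ≤ ENNReal.ofReal (d / α)) {C : ℝ≥0∞}
    (hC : ∀ ψ : ℝ≥0∞ → ℝ≥0∞, IsPsiFunction ψ s₁ s₂ →
      ∀ f : EuclideanSpace ℝ (Fin d) → ℝ, MemGrandLebesgue ψ s₁ s₂ f →
        grandLebesgueNorm (psiK d α ψ) (exponentQ d α s₁) (exponentQ d α s₂)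
          (rieszPotential α f) ≤ C * grandLebesgueNorm ψ s₁ s₂ f) : 1 ≤ C := by
  by_contra! hC1
  obtain ⟨p, hp⟩ := exists_between hs
  have hp1 := hs₁.trans_lt hp.1
  have hp2 := hp.2.trans_le hs₂
  have hK0 := (rieszConstant_pos hα hαd hp1 hp2).ne'
  have hKt := (rieszConstant_lt_top hα hαd hp1 hp2).ne
  have hcK : C * rieszConstant d α p < rieszConstant d α p := by
    simpa using ENNReal.mul_lt_mul_left hK0 hKt hC1
  obtain ⟨g, n, hgm, hgb, hlt⟩ := exists_bounded_lt_eLpNorm_rieszPotential hα hαd hp1 hp2 hcK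
  have hgs := hgm.aestronglyMeasurable (μ := volume)
  have hgp : MemLp g p volume :=
    memLp_of_norm_le_indicator hgs measurableSet_ball measure_ball_lt_top.ne hgb p
  have hg0 : ¬ g =ᵐ[volume] 0 := by
    intro h
    have hle := eLpNorm_rieszPotential_le hα hαd hp1 hp2 hgp
    rw [eLpNorm_congr_ae h, eLpNorm_zero, mul_zero] at hle hlt
    exact not_lt.2 hle hlt
  have hgn0 : eLpNorm g p volume ≠ 0 := fun h =>
    hg0 ((eLpNorm_eq_zero_iff hgs (zero_lt_one.trans hp1).ne').1 h)
  have hψ := isPsiFunction_eLpNorm hgs measurableSet_ball measure_ball_lt_top.ne hgb hg0 hs₁ hs.le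
    (ne_top_of_le_ne_top ENNReal.ofReal_ne_top hs₂)
  have hnorm : grandLebesgueNorm (fun r => eLpNorm g r volume) s₁ s₂ g ≤ 1 :=
    iSup₂_le fun q _ => ENNReal.div_self_le_one
  have h := (hC _ hψ g ⟨hgs, hnorm.trans_lt ENNReal.one_lt_top⟩).trans (mul_le_mul_right hnorm C)
  have hq := exponentQ_mem_Ioo hα hαd hs₂ hp
  have h' := (le_iSup₂ (f := fun q (_ : q ∈ Ioo (exponentQ d α s₁) (exponentQ d α s₂)) =>
    eLpNorm (rieszPotential α g) q volume / psiK d α (fun r => eLpNorm g r volume) q) _ hq).trans h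
  rw [psiK, exponentP_exponentQ hα hαd hp2.le, mul_one,
    ENNReal.div_le_iff (mul_ne_zero hK0 hgn0) (ENNReal.mul_ne_top hKt hgp.2.ne), ← mul_assoc] at h'
  exact not_lt.2 h' hlt

end Grand

theorem theorem3p1 (d : ℕ) (α : ℝ) (hα : 0 < α) (hαd : α < d)
    (s₁ s₂ : ℝ≥0∞) (hs₁ : 1 ≤ s₁) (hs : s₁ < s₂) (hs₂ : s₂ ≤ ENNReal.ofReal (d / α)) :
    -- the constant `K` is positive and finite, so that `ψ_K` takes values in `(0, ∞)`
    (∀ p ∈ Ioo s₁ s₂, 0 < rieszConstant d α p ∧ rieszConstant d α p < ∞) ∧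
    -- the potential exists, belongs to `Gψ_K`, and satisfies the norm inequality
    (∀ ψ : ℝ≥0∞ → ℝ≥0∞, IsPsiFunction ψ s₁ s₂ →
      ∀ f : EuclideanSpace ℝ (Fin d) → ℝ, MemGrandLebesgue ψ s₁ s₂ f →
        (∀ᵐ x : EuclideanSpace ℝ (Fin d), Integrable (rieszIntegrand α f x)) ∧
        MemGrandLebesgue (psiK d α ψ) (exponentQ d α s₁) (exponentQ d α s₂)
          (rieszPotential α f) ∧
        grandLebesgueNorm (psiK d α ψ) (exponentQ d α s₁) (exponentQ d α s₂)
          (rieszPotential α f) ≤ grandLebesgueNorm ψ s₁ s₂ f) ∧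
    -- the constant `1` cannot be replaced by a smaller one
    (∀ C : ℝ≥0∞,
      (∀ ψ : ℝ≥0∞ → ℝ≥0∞, IsPsiFunction ψ s₁ s₂ →
        ∀ f : EuclideanSpace ℝ (Fin d) → ℝ, MemGrandLebesgue ψ s₁ s₂ f →
          grandLebesgueNorm (psiK d α ψ) (exponentQ d α s₁) (exponentQ d α s₂)
            (rieszPotential α f) ≤ C * grandLebesgueNorm ψ s₁ s₂ f) →
      1 ≤ C) := by
  refine ⟨fun p hp => ?_, fun ψ hψ f hf => ?_,
    fun C hC => one_le_of_grandLebesgueNorm_rieszPotential_le hα hαd hs₁ hs hs₂ hC⟩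
  · exact ⟨rieszConstant_pos hα hαd (hs₁.trans_lt hp.1) (hp.2.trans_le hs₂),
      rieszConstant_lt_top hα hαd (hs₁.trans_lt hp.1) (hp.2.trans_le hs₂)⟩
  · have hle := grandLebesgueNorm_rieszPotential_le hα hαd hs₁ hs₂ hψ hf
    -- A single exponent in the interval suffices for convergence almost everywhere.
    obtain ⟨p, hp⟩ := exists_between hs
    exact ⟨ae_integrable_rieszIntegrand hα hαd (hs₁.trans_lt hp.1) (hp.2.trans_le hs₂)
      (hf.memLp hψ hp),
      ⟨aestronglyMeasurable_rieszPotential hf.aestronglyMeasurable,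
        hle.trans_lt hf.norm_lt_top⟩, hle⟩
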